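/- Let $\mathbb{H}^1=\mathbb{R}^2\times\mathbb{R}$ be the first Heisenberg group, with group law $(z,t)*(w,\tau)=\left(z+w,\,t+\tau+\tfrac12\omega(z,w)\right)$, where $\omega((x,y),(u,v))=xv-yu$. For $\theta\in[0,\pi)$ let $V_\theta\subset\mathbb{R}^2$ be the line spanned by $(\cos\theta,\sin\theta)$, let $\mathbb{V}_\theta=V_\theta\times\{0\}$ and let $\mathbb{V}_\theta^{\perp}=V_\theta^\perp\times\mathbb{R}$. Let $P_{\mathbb{V}_\theta}(z,t)=(\pi_{V_\theta}(z),0)$, where $\pi_W$ denotes Euclidean orthogonal projection onto $W$, and let $$P_{\mathbb{V}_\theta^\perp}(p)=P_{\mathbb{V}_\theta}(p)^{-1}*p,\qquad\text{that is,}\qquad P_{\mathbb{V}_\theta^\perp}(z,t)=\left(\pi_{V_\theta^\perp}(z),\;t-\tfrac12\,\omega\!\left(\pi_{V_\theta}(z),\pi_{V_\theta^\perp}(z)\right)\right),$$ be the vertical projection whose fibres are right cosets of $\mathbb{V}_\theta$. Write $B_E(x,r)$ for the open Euclidean ball, $\mathcal{H}^1$ for one-dimensional Hausdorff measure on $[0,\pi)$,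 and $P_{\mathbb{V}_\theta^\perp\#}\nu$ for the pushforward of $\nu$ under $P_{\mathbb{V}_\theta^\perp}$. Fix $s>1$, and let $\nu$ be a compactly supported Borel measure on $\mathbb{H}^1$ such that $$\sup_{x\in\mathbb{H}^1,\ r>0}\frac{\nu(B_E(x,r))}{r^s}<\infty .$$ Then for each $\kappa>\max\left\{\frac{s-1}{2},\ \frac{3(s-1)^2}{4s-3}\right\}$ there exist $\delta_0,\eta>0$ such that, for all $\delta\in(0,\delta_0)$, $$\nu\left\{x\in\mathbb{H}^1:\ \mathcal{H}^1\left\{\theta\in[0,\pi):\ P_{\mathbb{V}_\theta^\perp\#}\nu\left(B_E\left(P_{\mathbb{V}_\theta^\perp}(x),\delta\right)\right)\ge\delta^{s-\kappa}\right\}\ge\delta^{\eta}\right\}\le\delta^{\eta}.$$ -/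

import Mathlib

open MeasureTheory

noncomputable section

/-- The first Heisenberg group as a set, `ℝ² × ℝ`, with points `p = (x, y, t) = (p 0, p 1, p 2)`.
Its metric and Borel structure as a Lean type are the Euclidean ones, so that
`Metric.ball x r` is the open Euclidean ball. -/
abbrev Heis : Type := EuclideanSpace ℝ (Fin 3)

namespace Heis

/-- The symplectic form `ω(z, w) = x v - y u` of the planar parts `z = (x, y)`, `w = (u, v)`. -/
def omega (p q : Heis) : ℝ := p 0 * q 1 - p 1 * q 0

/-- The group law `(z, t) * (w, s) = (z + w, t + s + ω(z, w) / 2)`. -/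
def mul (p q : Heis) : Heis :=
  !₂[p 0 + q 0, p 1 + q 1, p 2 + q 2 + omega p q / 2]

/-- The group inverse `(z, t)⁻¹ = (-z, -t)`. -/
def inv (p : Heis) : Heis := !₂[-p 0, -p 1, -p 2]

/-- The unit vector `(cos θ, sin θ, 0)`, which spans the horizontal subgroup `𝕍_θ`. -/
def dir (θ : ℝ) : Heis := !₂[Real.cos θ, Real.sin θ, 0]

/-- The horizontal subgroup `𝕍_θ = V_θ × {0}`, where `V_θ` is the line through the origin of
`ℝ²` at angle `θ`. -/
def horizontal (θ : ℝ) : Submodule ℝ Heis := Submodule.span ℝ {dir θ}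

/-- The horizontal projection `P_{𝕍_θ}`: Euclidean orthogonal projection onto `𝕍_θ`,
i.e. `(z, t) ↦ (π_{V_θ} z, 0)`. -/
def horizProj (θ : ℝ) (p : Heis) : Heis := (horizontal θ).starProjection p

/-- The vertical projection onto `𝕍_θ^⊥` whose fibres are the right cosets of `𝕍_θ`:
`P_{𝕍_θ^⊥}(p) = P_{𝕍_θ}(p)⁻¹ * p`. -/
def vertProj (θ : ℝ) (p : Heis) : Heis := mul (inv (horizProj θ p)) p

/-- The Euclidean Frostman condition with exponent `s`:
`sup_{x, r > 0} ν(B_E(x, r)) / r ^ s < ∞`. -/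
def IsFrostman (ν : Measure Heis) (s : ℝ) : Prop :=
  (⨆ (x : Heis) (r : ℝ) (_ : 0 < r), ν (Metric.ball x r) / ENNReal.ofReal (r ^ s)) < ⊤

theorem norm_dir (θ : ℝ) : ‖dir θ‖ = 1 := by
  simp [dir, EuclideanSpace.norm_eq, Fin.sum_univ_three]

theorem horizProj_eq (θ : ℝ) (p : Heis) :
    horizProj θ p = (p 0 * Real.cos θ + p 1 * Real.sin θ) • dir θ := by
  refine (Submodule.starProjection_unit_singleton ℝ (norm_dir θ) p).trans ?_
  congr 1
  simp [dir, PiLp.inner_apply, Fin.sum_univ_three]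

/-- The explicit formula `P_{𝕍^⊥}(z, t) = (π_{V^⊥} z, t - ω(π_V z, π_{V^⊥} z) / 2)`. -/
theorem vertProj_eq (θ : ℝ) (p : Heis) :
    vertProj θ p =
      !₂[-(p 1 * Real.cos θ - p 0 * Real.sin θ) * Real.sin θ,
        (p 1 * Real.cos θ - p 0 * Real.sin θ) * Real.cos θ,
        p 2 - (p 0 * Real.cos θ + p 1 * Real.sin θ) *
          (p 1 * Real.cos θ - p 0 * Real.sin θ) / 2] := by
  have h := Real.sin_sq_add_cos_sq θ
  rw [vertProj, horizProj_eq]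
  ext i
  fin_cases i <;> simp [mul, inv, dir, omega]
  · linear_combination (-p 0) * h
  · linear_combination (-p 1) * h
  · ring

end Heis

end

/-! If the projections of `x` and `y` in direction `θ` are `δ`-close, then `|normalGap θ x y| < δ`
and, on bounded sets, `gap x y = O(δ)`. The second condition does not involve `θ`: for fixed `y` it
places `x` near a plane through `y`. The planes of two points `y`, `y'` at planar distance at least
`d` cross transversally, so the `x` near both and within `L` of `y` lie in an `O(δ/d)`-neighbourhood
of a segment of length `O(L)`, of measure `O(L (δ/d)^(s-1))` (`measure_commonStrip_le`).

Now count triples `(y, y', x)` with `y`, `y'` near fibres through `x` at distance between `ρ` and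
`L`, and `d`-separated. Integrating the strip bound gives at most `L^(s+1) (δ/d)^(s-1)` up to
constants (`measure_triples_le`). Conversely, let `x` have a set of angles of measure `h` whose
tubes have mass `a`. A given `y` serves only `O(δ/ρ)` of the angles, so the `y` have total mass at
least of order `h a ρ/δ`; so do the `y'`, even after removing angles close to that of `y`, which
makes `d` comparable to `h ρ` (`separation`). Hence such `x` have measure at most of order
`(L/ρ)^(s+1) (δ/h)^(s+1) / a^2` (`measure_rich_le`).

For `a = δ^(s-κ)` this is `δ^(2κ-(s-1))` up to small powers, a gain because `κ > (s-1)/2`.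
Pigeonholing over boundedly many scales makes `L/ρ` a small power of `1/δ`; the innermost ball is
negligible by the Frostman condition. -/

noncomputable section

namespace Heis

/-! ### Planar distance, gap and the geometry of fibres -/

/-- The Euclidean distance between the planar parts of two points. -/
def planarDist (x y : Heis) : ℝ := √((x 0 - y 0) ^ 2 + (x 1 - y 1) ^ 2)

/-- The vertical coordinate of `x * y⁻¹`; it vanishes when `x` and `y` lie on a common right coset
of a horizontal subgroup. -/
def gap (x y : Heis) : ℝ := x 2 - y 2 - omega x y / 2

/-- The signed planar distance from `x - y` to the line at angle `θ`. -/
def normalGap (θ : ℝ) (x y : Heis) : ℝ :=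
  (x 1 - y 1) * Real.cos θ - (x 0 - y 0) * Real.sin θ

theorem abs_apply_le_norm (x : Heis) (i : Fin 3) : |x i| ≤ ‖x‖ :=
  PiLp.norm_apply_le x i

theorem planarDist_nonneg (x y : Heis) : 0 ≤ planarDist x y := Real.sqrt_nonneg _

theorem planarDist_sq (x y : Heis) :
    planarDist x y ^ 2 = (x 0 - y 0) ^ 2 + (x 1 - y 1) ^ 2 :=
  Real.sq_sqrt (by positivity)

theorem abs_sub_zero_le_planarDist (x y : Heis) : |x 0 - y 0| ≤ planarDist x y :=
  Real.abs_le_sqrt (by nlinarith [sq_nonneg (x 1 - y 1)])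

theorem abs_sub_one_le_planarDist (x y : Heis) : |x 1 - y 1| ≤ planarDist x y :=
  Real.abs_le_sqrt (by nlinarith [sq_nonneg (x 0 - y 0)])

theorem dist_sq (x y : Heis) :
    dist x y ^ 2 = (x 0 - y 0) ^ 2 + (x 1 - y 1) ^ 2 + (x 2 - y 2) ^ 2 := by
  rw [EuclideanSpace.dist_eq, Real.sq_sqrt (by positivity)]
  simp [Fin.sum_univ_three, Real.dist_eq, sq_abs]

theorem planarDist_le_dist (x y : Heis) : planarDist x y ≤ dist x y := by
  refine Real.sqrt_le_iff.2 ⟨dist_nonneg, ?_⟩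
  rw [dist_sq]
  nlinarith [sq_nonneg (x 2 - y 2)]

theorem dist_le_planarDist_add (x y : Heis) : dist x y ≤ planarDist x y + |x 2 - y 2| := by
  have h0 := planarDist_nonneg x y
  have h1 := planarDist_sq x y
  refine abs_le_of_sq_le_sq' ?_ (by positivity) |>.2
  rw [dist_sq, ← h1, ← sq_abs (x 2 - y 2)]
  nlinarith [mul_nonneg h0 (abs_nonneg (x 2 - y 2))]

theorem abs_normalGap_le_planarDist (θ : ℝ) (x y : Heis) :
    |normalGap θ x y| ≤ planarDist x y := by
  refine Real.abs_le_sqrt ?_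
  unfold normalGap
  have h := Real.sin_sq_add_cos_sq θ
  have : ((x 1 - y 1) * Real.cos θ - (x 0 - y 0) * Real.sin θ) ^ 2
      + ((x 0 - y 0) * Real.cos θ + (x 1 - y 1) * Real.sin θ) ^ 2
      = (x 0 - y 0) ^ 2 + (x 1 - y 1) ^ 2 := by
    linear_combination ((x 0 - y 0) ^ 2 + (x 1 - y 1) ^ 2) * h
  nlinarith [sq_nonneg ((x 0 - y 0) * Real.cos θ + (x 1 - y 1) * Real.sin θ)]

theorem abs_normalGap_lt_of_dist_vertProj_lt {θ δ : ℝ} {x y : Heis}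
    (h : dist (vertProj θ x) (vertProj θ y) < δ) : |normalGap θ x y| < δ := by
  refine lt_of_le_of_lt (abs_le_of_sq_le_sq' ?_ dist_nonneg |> abs_le.2) h
  rw [dist_sq, vertProj_eq, vertProj_eq]
  simp only [normalGap, Matrix.cons_val_zero, Matrix.cons_val_one,
    Matrix.cons_val]
  have hc := Real.sin_sq_add_cos_sq θ
  refine le_trans (le_of_eq ?_) (le_add_of_nonneg_right (sq_nonneg _))
  linear_combination (-((x 1 - y 1) * Real.cos θ - (x 0 - y 0) * Real.sin θ) ^ 2) * hc

/-- The last coordinates of the two projections differ by `gap x y` minus half of `normalGap θ x y`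
times the sum of the components of `x` and `y` along `θ`; that sum is at most `4 * M`. -/
theorem abs_gap_le_of_dist_vertProj_lt {θ δ M : ℝ} (hM : 1 ≤ M) {x y : Heis}
    (hx : ‖x‖ ≤ M) (hy : ‖y‖ ≤ M)
    (h : dist (vertProj θ x) (vertProj θ y) < δ) : |gap x y| ≤ 3 * M * δ := by
  have h1 := (abs_normalGap_lt_of_dist_vertProj_lt h).le
  have hδ : 0 ≤ δ := dist_nonneg.trans h.le
  have h2 : |(vertProj θ x) 2 - (vertProj θ y) 2| ≤ δ := by
    refine le_trans ?_ h.le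
    rw [dist_eq_norm]
    exact abs_apply_le_norm (vertProj θ x - vertProj θ y) 2
  rw [vertProj_eq, vertProj_eq] at h2
  simp only [Matrix.cons_val] at h2
  have hA : ∀ p : Heis, ‖p‖ ≤ M → |p 0 * Real.cos θ + p 1 * Real.sin θ| ≤ 2 * M := by
    intro p hp
    refine (abs_add_le _ _).trans ?_
    rw [abs_mul, abs_mul]
    have := mul_le_mul ((abs_apply_le_norm p 0).trans hp) (Real.abs_cos_le_one θ)
      (abs_nonneg _) (by linarith)
    have := mul_le_mul ((abs_apply_le_norm p 1).trans hp) (Real.abs_sin_le_one θ)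
      (abs_nonneg _) (by linarith)
    linarith
  have h3 := (abs_add_le _ _).trans (add_le_add (hA x hx) (hA y hy))
  have h4 := mul_le_mul h3 h1 (abs_nonneg _) (by linarith)
  rw [← abs_mul] at h4
  have hc := Real.sin_sq_add_cos_sq θ
  rw [abs_le] at h2 h4 ⊢
  unfold gap omega
  have key : ((x 0 * Real.cos θ + x 1 * Real.sin θ) + (y 0 * Real.cos θ + y 1 * Real.sin θ))
      * normalGap θ x y =
      (x 0 * Real.cos θ + x 1 * Real.sin θ) * (x 1 * Real.cos θ - x 0 * Real.sin θ)
      - (y 0 * Real.cos θ + y 1 * Real.sin θ) * (y 1 * Real.cos θ - y 0 * Real.sin θ)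
      - (x 0 * y 1 - x 1 * y 0) := by
    unfold normalGap
    linear_combination (x 1 * y 0 - x 0 * y 1) * hc
  rw [key] at h4
  constructor <;> nlinarith

theorem abs_omega_sub_le {M : ℝ} {x x' y : Heis} (hy : ‖y‖ ≤ M) :
    |omega (x - x') y| ≤ 2 * M * planarDist x x' := by
  have h0 := abs_sub_zero_le_planarDist x x'
  have h1 := abs_sub_one_le_planarDist x x'
  have hp := planarDist_nonneg x x'
  unfold omega
  refine (abs_sub _ _).trans ?_
  rw [abs_mul, abs_mul]
  have a := mul_le_mul h0 ((abs_apply_le_norm y 1).trans hy) (abs_nonneg _) hp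
  have b := mul_le_mul h1 ((abs_apply_le_norm y 0).trans hy) (abs_nonneg _) hp
  simp only [PiLp.sub_apply] at *
  linarith

/-- Since `omega y y = 0`, the vertical difference is `gap x y + omega (x - y) y / 2`, so planar
distance and gap control the full distance. -/
theorem dist_le_of_gap_le {M δ L : ℝ} (hM : 1 ≤ M) {x y : Heis} (hy : ‖y‖ ≤ M)
    (hg : |gap x y| ≤ 3 * M * δ) (hδ : δ ≤ L) (hp : planarDist x y ≤ L) :
    dist x y ≤ 5 * M * L := by
  have hL : 0 ≤ L := (planarDist_nonneg x y).trans hp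
  have h1 := dist_le_planarDist_add x y
  have h2 := abs_omega_sub_le (x := x) (x' := y) hy
  have h3 : |x 2 - y 2| ≤ 4 * M * L := by
    have e : x 2 - y 2 = gap x y + omega (x - y) y / 2 := by
      simp only [gap, omega, PiLp.sub_apply]; ring
    rw [abs_le] at *
    rw [e]
    constructor <;> nlinarith
  nlinarith

/-! ### Transversality in the angle -/

/-- As `x - y` is nearly parallel to `θ`, its normal component at the transverse angle `θ'` has size
about `ρ |sin (θ - θ')|`, whereas that of `x - y'` is below `δ`. -/
theorem separation {θ θ' τ δ ρ : ℝ} {x y y' : Heis} (hρ : ρ ≤ planarDist x y)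
    (h : |normalGap θ x y| < δ) (h' : |normalGap θ' x y'| < δ)
    (hs : τ ≤ |Real.sin (θ - θ')|) (hτ : 0 ≤ τ) (hδ : 8 * δ ≤ τ * ρ) :
    τ * ρ / 2 ≤ planarDist y y' := by
  have hδ0 : 0 ≤ δ := (abs_nonneg _).trans h.le
  refine le_trans ?_ (abs_normalGap_le_planarDist θ' y y')
  set A := (x 0 - y 0) * Real.cos θ + (x 1 - y 1) * Real.sin θ with hA
  have hc := Real.sin_sq_add_cos_sq θ
  have hsq : A ^ 2 + normalGap θ x y ^ 2 = planarDist x y ^ 2 := by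
    rw [planarDist_sq, hA]; unfold normalGap
    linear_combination ((x 0 - y 0) ^ 2 + (x 1 - y 1) ^ 2) * hc
  have hA1 : ρ - δ ≤ |A| := by
    have : planarDist x y ≤ |A| + |normalGap θ x y| := by
      refine abs_le_of_sq_le_sq' ?_ (by positivity) |>.2
      rw [← hsq, ← sq_abs A, ← sq_abs (normalGap θ x y)]
      nlinarith [mul_nonneg (abs_nonneg A) (abs_nonneg (normalGap θ x y))]
    linarith
  have e : A * Real.sin (θ - θ') + normalGap θ x y * Real.cos (θ - θ') =
      normalGap θ' x y := by
    rw [Real.sin_sub, Real.cos_sub, hA]; unfold normalGap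
    linear_combination ((x 1 - y 1) * Real.cos θ' - (x 0 - y 0) * Real.sin θ') * hc
  have hs1 := Real.abs_sin_le_one (θ - θ')
  have f1 : |A * Real.sin (θ - θ')| ≤ |normalGap θ' x y| + |normalGap θ x y| := by
    have : A * Real.sin (θ - θ') = normalGap θ' x y - normalGap θ x y * Real.cos (θ - θ') := by
      linarith
    rw [this]
    refine (abs_sub _ _).trans (add_le_add_right ?_ _)
    rw [abs_mul]
    exact mul_le_of_le_one_right (abs_nonneg _) (Real.abs_cos_le_one _)
  have f2 : |normalGap θ' x y| ≤ |normalGap θ' y y'| + |normalGap θ' x y'| := by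
    have : normalGap θ' x y = normalGap θ' x y' - normalGap θ' y y' := by
      unfold normalGap; ring
    rw [this, add_comm]
    exact abs_sub _ _
  rw [abs_mul] at f1
  have f3 : τ * ρ - δ ≤ |A| * |Real.sin (θ - θ')| := by
    have g1 : |A| * τ ≤ |A| * |Real.sin (θ - θ')| :=
      mul_le_mul_of_nonneg_left hs (abs_nonneg _)
    have g2 : (ρ - δ) * τ ≤ |A| * τ := mul_le_mul_of_nonneg_right hA1 hτ
    nlinarith
  linarith

theorem volume_abs_sin_sub_lt_le {φ τ : ℝ} (hφ : φ ∈ Set.Icc (-Real.pi) Real.pi) :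
    volume {θ : ℝ | θ ∈ Set.Ico 0 Real.pi ∧ |Real.sin (θ - φ)| < τ} ≤
      ENNReal.ofReal (4 * Real.pi * τ) := by
  have hpi := Real.pi_pos
  -- Jordan's inequality puts `θ` within `π τ / 2` of some `φ + k π`; as `(θ - φ) / π` lies in `[-1,
  -- 2]`, four values of `k` suffice.
  have hsub : {θ : ℝ | θ ∈ Set.Ico 0 Real.pi ∧ |Real.sin (θ - φ)| < τ} ⊆
      ⋃ k ∈ Finset.Icc (-1 : ℤ) 2, Metric.ball (φ + k * Real.pi) (Real.pi * τ / 2) := by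
    rintro θ ⟨⟨h0, h1⟩, hs⟩
    set k := round ((θ - φ) / Real.pi) with hk
    have hr := abs_sub_round ((θ - φ) / Real.pi)
    rw [← hk] at hr
    have e : (θ - φ) / Real.pi * Real.pi = θ - φ := by field_simp
    have hb : |θ - φ - k * Real.pi| ≤ Real.pi / 2 := by
      have : θ - φ - k * Real.pi = ((θ - φ) / Real.pi - k) * Real.pi := by
        rw [sub_mul, e]
      rw [this, abs_mul, abs_of_pos hpi]
      nlinarith
    have hlow := Real.mul_abs_le_abs_sin hb
    have hsin : |Real.sin (θ - φ - k * Real.pi)| = |Real.sin (θ - φ)| := by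
      rw [Real.sin_sub_int_mul_pi, abs_mul]
      simp [abs_zpow]
    rw [hsin] at hlow
    simp only [Set.mem_iUnion, Finset.mem_Icc, Metric.mem_ball, Real.dist_eq]
    rw [abs_le] at hr
    have g1 : (-1 : ℝ) ≤ (θ - φ) / Real.pi := by
      rw [le_div_iff₀ hpi]; linarith [hφ.2]
    have g2 : (θ - φ) / Real.pi ≤ 2 := by
      rw [div_le_iff₀ hpi]; linarith [hφ.1]
    refine ⟨k, ⟨?_, ?_⟩, ?_⟩
    · have : (-2 : ℝ) < k := by linarith
      have : (-2 : ℤ) < k := by exact_mod_cast this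
      omega
    · have : (k : ℝ) < 3 := by linarith
      have : k < (3 : ℤ) := by exact_mod_cast this
      omega
    · rw [← sub_sub]
      have : 2 / Real.pi * |θ - φ - k * Real.pi| < τ := hlow.trans_lt hs
      rw [div_mul_eq_mul_div, div_lt_iff₀ hpi] at this
      linarith
  refine (measure_mono hsub).trans ((measure_biUnion_finset_le _ _).trans ?_)
  have : ∀ k ∈ Finset.Icc (-1 : ℤ) 2,
      volume (Metric.ball (φ + k * Real.pi) (Real.pi * τ / 2)) = ENNReal.ofReal (Real.pi * τ) := by
    intro k _
    rw [Real.volume_ball]; congr 1; ring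
  rw [Finset.sum_congr rfl this, Finset.sum_const, nsmul_eq_mul]
  rw [show (Finset.Icc (-1 : ℤ) 2).card = 4 from rfl,
    show ((4 : ℕ) : ENNReal) = ENNReal.ofReal 4 by simp, ← ENNReal.ofReal_mul (by norm_num)]
  exact le_of_eq (by congr 1; ring)

/-- In polar coordinates, `normalGap θ x y` is, up to sign, the planar distance times the sine of
`θ` minus the argument of the planar part of `x - y`. -/
theorem volume_abs_normalGap_lt_le {δ ρ : ℝ} {x y : Heis} (hρ0 : 0 < ρ)
    (hρ : ρ ≤ planarDist x y) :
    volume {θ : ℝ | θ ∈ Set.Ico 0 Real.pi ∧ |normalGap θ x y| < δ} ≤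
      ENNReal.ofReal (4 * Real.pi * (δ / ρ)) := by
  set z : ℂ := ⟨x 0 - y 0, x 1 - y 1⟩ with hz
  have hn : ‖z‖ = planarDist x y := by
    rw [Complex.norm_def, Complex.normSq_apply]
    simp only [planarDist, hz, sq]
  refine (measure_mono ?_).trans (volume_abs_sin_sub_lt_le (φ := z.arg)
    ⟨(Complex.neg_pi_lt_arg z).le, Complex.arg_le_pi z⟩)
  rintro θ ⟨hθ, h⟩
  refine ⟨hθ, ?_⟩
  have h0 : x 0 - y 0 = ‖z‖ * Real.cos z.arg := (Complex.norm_mul_cos_arg z).symm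
  have h1 : x 1 - y 1 = ‖z‖ * Real.sin z.arg := (Complex.norm_mul_sin_arg z).symm
  have e : normalGap θ x y = -(planarDist x y * Real.sin (θ - z.arg)) := by
    rw [← hn, Real.sin_sub]; unfold normalGap
    rw [h0, h1]; ring
  rw [e, abs_neg, abs_mul, abs_of_nonneg (planarDist_nonneg x y)] at h
  rw [lt_div_iff₀ hρ0]
  nlinarith [mul_le_mul_of_nonneg_right hρ (abs_nonneg (Real.sin (θ - z.arg)))]

/-! ### Points near the fibres of two given points -/

/-- Slice `X` by the values of `f` into bins of width `w`; each bin lies in one ball of radius `r`.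
-/
theorem measure_le_of_coordinate {ν : Measure Heis} {s C : ℝ}
    (hF : ∀ x : Heis, ∀ r : ℝ, 0 < r → ν (Metric.ball x r) ≤ ENNReal.ofReal (C * r ^ s))
    {X : Set Heis} {f : Heis → ℝ} {α L w r : ℝ} (hw : 0 < w) (hL : 0 ≤ L) (hr : 0 < r)
    (hC : 0 ≤ C) (hf : ∀ x ∈ X, |f x - α| ≤ L)
    (hd : ∀ x ∈ X, ∀ x' ∈ X, |f x - f x'| ≤ w → dist x x' < r) :
    ν X ≤ ENNReal.ofReal ((2 * L / w + 1) * (C * r ^ s)) := by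
  set N := ⌊2 * L / w⌋₊ + 1 with hN
  set g : Heis → ℝ := fun x => (f x - α + L) / w with hg
  have hg0 : ∀ x ∈ X, 0 ≤ g x := fun x hx => by
    have := abs_le.1 (hf x hx)
    exact div_nonneg (by linarith) hw.le
  have hsub : X ⊆ ⋃ k ∈ Finset.range N, {x | x ∈ X ∧ ⌊g x⌋₊ = k} := by
    intro x hx
    simp only [Set.mem_iUnion, Finset.mem_range]
    refine ⟨⌊g x⌋₊, ?_, hx, rfl⟩
    rw [hN, Nat.lt_succ_iff]
    refine Nat.floor_le_floor ?_
    have := abs_le.1 (hf x hx)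
    exact div_le_div_of_nonneg_right (by linarith) hw.le
  have hbin : ∀ k ∈ Finset.range N,
      ν {x | x ∈ X ∧ ⌊g x⌋₊ = k} ≤ ENNReal.ofReal (C * r ^ s) := by
    intro k _
    rcases Set.eq_empty_or_nonempty {x | x ∈ X ∧ ⌊g x⌋₊ = k} with h | ⟨x', hx', hk'⟩
    · rw [h]; simp
    · refine (measure_mono ?_).trans (hF x' r hr)
      rintro x ⟨hx, hk⟩
      refine hd x hx x' hx' ?_
      have a1 := Nat.floor_le (hg0 x hx)
      have a2 := Nat.lt_floor_add_one (g x)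
      have b1 := Nat.floor_le (hg0 x' hx')
      have b2 := Nat.lt_floor_add_one (g x')
      rw [hk] at a1 a2
      rw [hk'] at b1 b2
      have e : f x - f x' = (g x - g x') * w := by
        simp only [hg]; field_simp; ring
      rw [e, abs_mul, abs_of_pos hw]
      have : |g x - g x'| ≤ 1 := by rw [abs_le]; constructor <;> linarith
      nlinarith
  refine (measure_mono hsub).trans ((measure_biUnion_finset_le _ _).trans ?_)
  refine (Finset.sum_le_sum hbin).trans ?_
  rw [Finset.sum_const, nsmul_eq_mul, Finset.card_range, ← ENNReal.ofReal_natCast,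
    ← ENNReal.ofReal_mul (Nat.cast_nonneg _)]
  refine ENNReal.ofReal_le_ofReal ?_
  have : (N : ℝ) ≤ 2 * L / w + 1 := by
    rw [hN]; push_cast
    have := Nat.floor_le (show 0 ≤ 2 * L / w by positivity)
    linarith
  exact mul_le_mul_of_nonneg_right this (by positivity)

/-- The points at planar distance at most `L` from `y` whose `δ`-fibres meet both `y` and `y'`. -/
def commonStrip (M δ L : ℝ) (y y' : Heis) : Set Heis :=
  {x | ‖x‖ ≤ M ∧ planarDist x y ≤ L ∧ |gap x y| ≤ 3 * M * δ ∧ |gap x y'| ≤ 3 * M * δ}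

/-- The difference `gap x y - gap x y'` is affine in `x` and measures the planar component of `x`
normal to `y - y'`, which is thus confined to width `O(δ/d)`. The height of `x` is then fixed by
`gap x y`, leaving only the coordinate along `y - y'`, which is sliced at width `δ/d`. -/
theorem measure_commonStrip_le {ν : Measure Heis} {s C M δ L d : ℝ} (hs : 1 < s) (hC : 0 ≤ C)
    (hF : ∀ x : Heis, ∀ r : ℝ, 0 < r → ν (Metric.ball x r) ≤ ENNReal.ofReal (C * r ^ s))
    (hM : 1 ≤ M) (hδ : 0 < δ) (hL : δ ≤ L) (hd : 0 < d) {y y' : Heis} (hy : ‖y‖ ≤ M)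
    (hy' : ‖y'‖ ≤ M) (hyy : d ≤ planarDist y y') :
    ν (commonStrip M δ L y y') ≤
      ENNReal.ofReal (3 * C * (75 * M ^ 2) ^ s * (L * (δ / d) ^ (s - 1))) := by
  set w := δ / d with hw
  have hw0 : 0 < w := div_pos hδ hd
  have hL0 : 0 < L := hδ.trans_le hL
  have hM2 : M ≤ M ^ 2 := by nlinarith
  rcases le_or_gt w L with hwL | hwL
  · set v := planarDist y y' with hv
    have hv0 : 0 < v := hd.trans_le hyy
    have hv2 : v ^ 2 = (y 0 - y' 0) ^ 2 + (y 1 - y' 1) ^ 2 := planarDist_sq y y'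
    have hδv : δ ≤ w * v := by
      rw [hw, div_mul_eq_mul_div, le_div_iff₀ hd]
      exact mul_le_mul_of_nonneg_left hyy hδ.le
    have hvM : v ≤ 2 * M := by
      refine (planarDist_le_dist y y').trans ?_
      rw [dist_eq_norm]
      exact (norm_sub_le _ _).trans (by linarith)
    set f : Heis → ℝ := fun x => (x 0 * (y 0 - y' 0) + x 1 * (y 1 - y' 1)) / v with hf
    have hfv : ∀ x x' : Heis, (f x - f x') * v =
        (x 0 - x' 0) * (y 0 - y' 0) + (x 1 - x' 1) * (y 1 - y' 1) := by
      intro x x'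
      simp only [hf]; field_simp; ring
    -- Lagrange's identity: components along and across `y - y'`.
    have hlag : ∀ x x' : Heis, ((f x - f x') * v) ^ 2 +
        ((x 0 - x' 0) * (y 1 - y' 1) - (x 1 - x' 1) * (y 0 - y' 0)) ^ 2 =
          (planarDist x x' * v) ^ 2 := by
      intro x x'
      rw [hfv, mul_pow, planarDist_sq, hv2]; ring
    refine (measure_le_of_coordinate hF (f := f) (α := f y) (L := L) (w := w)
      (r := 75 * M ^ 2 * w) hw0 hL0.le (by positivity) hC ?_ ?_).trans ?_
    · rintro x ⟨-, hx, -, -⟩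
      refine le_trans ?_ hx
      have h1 : |(f x - f y) * v| ≤ planarDist x y * v := by
        refine abs_le_of_sq_le_sq ?_ (mul_nonneg (planarDist_nonneg _ _) hv0.le)
        rw [← hlag]
        exact le_add_of_nonneg_right (sq_nonneg _)
      rw [abs_mul, abs_of_pos hv0] at h1
      exact le_of_mul_le_mul_right h1 hv0
    · rintro x ⟨-, -, h1, h2⟩ x' ⟨-, -, h1', h2'⟩ hxx
      have hperp : |(x 0 - x' 0) * (y 1 - y' 1) - (x 1 - x' 1) * (y 0 - y' 0)| ≤
          24 * M * δ := by
        have e : (x 0 - x' 0) * (y 1 - y' 1) - (x 1 - x' 1) * (y 0 - y' 0) =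
            -2 * ((gap x y - gap x y') - (gap x' y - gap x' y')) := by
          unfold gap omega; ring
        rw [e]
        rw [abs_le] at *
        constructor <;> linarith
      have hpl : planarDist x x' ≤ 25 * M * w := by
        have h3 : planarDist x x' * v ≤ w * v + 24 * M * δ := by
          have a1 : |(f x - f x') * v| ≤ w * v := by
            rw [abs_mul, abs_of_pos hv0]
            exact mul_le_mul_of_nonneg_right hxx hv0.le
          refine le_trans ?_ (add_le_add a1 hperp)
          refine abs_le_of_sq_le_sq' ?_ (by positivity) |>.2
          rw [← hlag, ← sq_abs ((f x - f x') * v),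
            ← sq_abs ((x 0 - x' 0) * (y 1 - y' 1) - (x 1 - x' 1) * (y 0 - y' 0))]
          have := mul_nonneg (abs_nonneg ((f x - f x') * v))
            (abs_nonneg ((x 0 - x' 0) * (y 1 - y' 1) - (x 1 - x' 1) * (y 0 - y' 0)))
          nlinarith
        have h4 : planarDist x x' * v ≤ 25 * M * w * v := by
          have a2 : 24 * M * δ ≤ 24 * M * (w * v) :=
            mul_le_mul_of_nonneg_left hδv (by positivity)
          have a3 : w * v ≤ M * (w * v) := le_mul_of_one_le_left (by positivity) hM
          nlinarith
        exact le_of_mul_le_mul_right h4 hv0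
      have ht : |x 2 - x' 2| ≤ 6 * M * δ + M * planarDist x x' := by
        have e : x 2 - x' 2 = gap x y - gap x' y + omega (x - x') y / 2 := by
          simp only [gap, omega, PiLp.sub_apply]; ring
        have h5 := abs_omega_sub_le (x := x) (x' := x') hy
        rw [e]
        rw [abs_le] at *
        constructor <;> linarith
      have hδw : δ ≤ 2 * M * w := by nlinarith
      have h6 := dist_le_planarDist_add x x'
      have h7 : M * planarDist x x' ≤ M * (25 * M * w) :=
        mul_le_mul_of_nonneg_left hpl (by linarith)
      have h8 : M * δ ≤ M * (2 * M * w) := mul_le_mul_of_nonneg_left hδw (by linarith)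
      have h9 : M * w ≤ M ^ 2 * w := mul_le_mul_of_nonneg_right hM2 hw0.le
      have h10 : 0 < M ^ 2 * w := by positivity
      nlinarith
    · refine ENNReal.ofReal_le_ofReal ?_
      have e1 : 2 * L / w + 1 ≤ 3 * L / w := by
        rw [div_add_one hw0.ne']
        exact div_le_div_of_nonneg_right (by linarith) hw0.le
      refine (mul_le_mul_of_nonneg_right e1 (by positivity)).trans (le_of_eq ?_)
      rw [Real.mul_rpow (by positivity) hw0.le, Real.rpow_sub_one hw0.ne']
      ring
  -- When `L < w` a single ball of radius comparable to `L` is enough, because `L ^ s ≤ L * w ^ (s -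
  -- 1)`.
  · have hsub : commonStrip M δ L y y' ⊆ Metric.ball y (75 * M ^ 2 * L) := by
      rintro x ⟨-, h1, h2, -⟩
      refine (dist_le_of_gap_le hM hy h2 hL h1).trans_lt ?_
      have : M * L ≤ M ^ 2 * L := mul_le_mul_of_nonneg_right hM2 hL0.le
      have : 0 < M ^ 2 * L := by positivity
      nlinarith
    refine (measure_mono hsub).trans ((hF _ _ (by positivity)).trans ?_)
    refine ENNReal.ofReal_le_ofReal ?_
    rw [Real.mul_rpow (by positivity) hL0.le]
    have e : L ^ s ≤ L * w ^ (s - 1) := by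
      have : L ^ s = L * L ^ (s - 1) := by
        rw [Real.rpow_sub_one hL0.ne']; field_simp
      rw [this]
      exact mul_le_mul_of_nonneg_left
        (Real.rpow_le_rpow hL0.le hwL.le (by linarith)) hL0.le
    have p : 0 ≤ C * (75 * M ^ 2) ^ s := by positivity
    have q : 0 ≤ L * w ^ (s - 1) := by positivity
    nlinarith [mul_le_mul_of_nonneg_left e p, mul_nonneg p q]

/-! ### Tubes, rich angles and double counting -/

/-- If every `θ` in `Θ` has a fibre of measure at least `a` inside `Y`, while each point lies in
the fibres of a set of `θ` of measure at most `b`, then `Y` is large. -/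
theorem mul_le_mul_measure_of_fibres {ν : Measure Heis} [SFinite ν] {G : Set (ℝ × Heis)}
    (hG : MeasurableSet G) {Θ : Set ℝ} (hΘ : MeasurableSet Θ) {Y : Set Heis} {a b : ENNReal}
    (ha : ∀ θ ∈ Θ, a ≤ ν {y | (θ, y) ∈ G}) (hY : ∀ θ ∈ Θ, ∀ y, (θ, y) ∈ G → y ∈ Y)
    (hb : ∀ y, volume {θ | θ ∈ Θ ∧ (θ, y) ∈ G} ≤ b) :
    volume Θ * a ≤ b * ν Y := by
  set H : Set (ℝ × Heis) := {p | p.1 ∈ Θ ∧ p ∈ G} with hH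
  have hHm : MeasurableSet H := (measurable_fst hΘ).inter hG
  have h1 : volume Θ * a ≤ (volume.prod ν) H := by
    rw [Measure.prod_apply hHm, mul_comm, ← lintegral_indicator_const hΘ]
    refine lintegral_mono fun θ => ?_
    by_cases hθ : θ ∈ Θ
    · rw [Set.indicator_of_mem hθ]
      refine (ha θ hθ).trans (measure_mono fun y hy => ⟨hθ, hy⟩)
    · rw [Set.indicator_of_notMem hθ]; exact zero_le
  have h2 : (volume.prod ν) H ≤ b * ν Y := by
    rw [Measure.prod_apply_symm hHm]
    -- `Y` need not be measurable, so its measurable hull replaces it at no cost in measure.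
    refine le_trans (lintegral_mono (g := (toMeasurable ν Y).indicator fun _ => b) fun y => ?_) ?_
    · by_cases hy : y ∈ toMeasurable ν Y
      · rw [Set.indicator_of_mem hy]
        exact hb y
      · rw [Set.indicator_of_notMem hy]
        refine (measure_mono_null (t := ∅) ?_ measure_empty).le
        rintro θ ⟨hθ, hθy⟩
        exact hy (subset_toMeasurable ν Y (hY θ hθ y hθy))
    · rw [lintegral_indicator_const (measurableSet_toMeasurable ν Y), measure_toMeasurable]
  exact h1.trans h2

@[fun_prop]
theorem continuous_apply' (i : Fin 3) : Continuous fun x : Heis => x i :=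
  PiLp.continuous_apply 2 _ i

@[fun_prop]
theorem continuous_planarDist {α : Type*} [TopologicalSpace α] {f g : α → Heis}
    (hf : Continuous f) (hg : Continuous g) : Continuous fun a => planarDist (f a) (g a) := by
  unfold planarDist
  exact Real.continuous_sqrt.comp (by fun_prop)

@[fun_prop]
theorem continuous_gap {α : Type*} [TopologicalSpace α] {f g : α → Heis}
    (hf : Continuous f) (hg : Continuous g) : Continuous fun a => gap (f a) (g a) := by
  unfold gap omega
  fun_prop

@[fun_prop]
theorem continuous_normalGap {α : Type*} [TopologicalSpace α] {t : α → ℝ} {f g : α → Heis}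
    (ht : Continuous t) (hf : Continuous f) (hg : Continuous g) :
    Continuous fun a => normalGap (t a) (f a) (g a) := by
  unfold normalGap
  fun_prop

/-- The pairs `(θ, y)` with `y` in the `δ`-neighbourhood of the fibre of `x` in direction `θ`, at
planar distance between `ρ` and `L` from `x`. -/
def tubes (M δ ρ L : ℝ) (x : Heis) : Set (ℝ × Heis) :=
  {p | ‖p.2‖ ≤ M ∧ |normalGap p.1 x p.2| < δ ∧ |gap x p.2| ≤ 3 * M * δ ∧
    ρ ≤ planarDist x p.2 ∧ planarDist x p.2 ≤ L}

theorem measurableSet_tubes (M δ ρ L : ℝ) (x : Heis) : MeasurableSet (tubes M δ ρ L x) := by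
  simp only [tubes, Set.ofPred_and]
  refine MeasurableSet.inter (IsClosed.measurableSet (isClosed_le (by fun_prop) (by fun_prop)))
    (MeasurableSet.inter (IsOpen.measurableSet (isOpen_lt (by fun_prop) (by fun_prop)))
    (MeasurableSet.inter (IsClosed.measurableSet (isClosed_le (by fun_prop) (by fun_prop)))
    (MeasurableSet.inter (IsClosed.measurableSet (isClosed_le (by fun_prop) (by fun_prop)))
    (IsClosed.measurableSet (isClosed_le (by fun_prop) (by fun_prop))))))

/-- The angles in whose direction the tube around `x` has measure at least `a`. -/
def richAngles (ν : Measure Heis) (M δ ρ L a : ℝ) (x : Heis) : Set ℝ :=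
  {θ | θ ∈ Set.Ico 0 Real.pi ∧ ENNReal.ofReal a ≤ ν {y | (θ, y) ∈ tubes M δ ρ L x}}

theorem measurableSet_richAngles (ν : Measure Heis) [SFinite ν] (M δ ρ L a : ℝ) (x : Heis) :
    MeasurableSet (richAngles ν M δ ρ L a x) :=
  measurableSet_Ico.inter
    (measurable_measure_prodMk_left (measurableSet_tubes M δ ρ L x) measurableSet_Ici)

/-- Triples `((y, y'), x)` for which `x` has `δ`-fibres meeting `y` and `y'`, with `y`, `y'`
separated. -/
def triples (M δ L d : ℝ) : Set ((Heis × Heis) × Heis) :=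
  {p | ‖p.1.1‖ ≤ M ∧ ‖p.1.2‖ ≤ M ∧ ‖p.2‖ ≤ M ∧ planarDist p.2 p.1.1 ≤ L ∧
    planarDist p.2 p.1.2 ≤ L ∧ |gap p.2 p.1.1| ≤ 3 * M * δ ∧ |gap p.2 p.1.2| ≤ 3 * M * δ ∧
    d ≤ planarDist p.1.1 p.1.2}

theorem measurableSet_triples (M δ L d : ℝ) : MeasurableSet (triples M δ L d) := by
  simp only [triples, Set.ofPred_and]
  refine IsClosed.measurableSet ?_
  refine IsClosed.inter (isClosed_le (by fun_prop) (by fun_prop))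
    (IsClosed.inter (isClosed_le (by fun_prop) (by fun_prop))
    (IsClosed.inter (isClosed_le (by fun_prop) (by fun_prop))
    (IsClosed.inter (isClosed_le (by fun_prop) (by fun_prop))
    (IsClosed.inter (isClosed_le (by fun_prop) (by fun_prop))
    (IsClosed.inter (isClosed_le (by fun_prop) (by fun_prop))
    (IsClosed.inter (isClosed_le (by fun_prop) (by fun_prop))
    (isClosed_le (by fun_prop) (by fun_prop))))))))

/-- Integrate the strip bound over pairs `(y, y')`. Both lie within `5 * M * L` of `x`, so `y'`
ranges over a ball about `y` of radius `11 * M * L`. -/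
theorem measure_triples_le {ν : Measure Heis} [SFinite ν] {s C M δ L d : ℝ} (hs : 1 < s)
    (hC : 0 ≤ C)
    (hF : ∀ x : Heis, ∀ r : ℝ, 0 < r → ν (Metric.ball x r) ≤ ENNReal.ofReal (C * r ^ s))
    (hM : 1 ≤ M) (hδ : 0 < δ) (hL : δ ≤ L) (hd : 0 < d) :
    ((ν.prod ν).prod ν) (triples M δ L d) ≤
      ENNReal.ofReal (3 * C * (75 * M ^ 2) ^ s * (L * (δ / d) ^ (s - 1))) *
        (ENNReal.ofReal (C * (11 * M * L) ^ s) * ENNReal.ofReal (C * (2 * M) ^ s)) := by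
  have hL0 : 0 < L := hδ.trans_le hL
  set S := ENNReal.ofReal (3 * C * (75 * M ^ 2) ^ s * (L * (δ / d) ^ (s - 1)))
  set B := ENNReal.ofReal (C * (11 * M * L) ^ s)
  set P : Set (Heis × Heis) := {q | ‖q.1‖ < 2 * M ∧ dist q.1 q.2 < 11 * M * L} with hP
  have hPm : MeasurableSet P := by
    rw [hP, Set.ofPred_and]
    exact (IsOpen.inter (isOpen_lt (by fun_prop) (by fun_prop))
      (isOpen_lt (by fun_prop) (by fun_prop))).measurableSet
  rw [Measure.prod_apply (measurableSet_triples M δ L d)]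
  have h1 : ∀ q : Heis × Heis, ν (Prod.mk q ⁻¹' triples M δ L d) ≤ P.indicator (fun _ => S) q := by
    rintro ⟨y, y'⟩
    rcases Set.eq_empty_or_nonempty (Prod.mk (y, y') ⁻¹' triples M δ L d) with h | ⟨x, hx⟩
    · rw [h]; simp
    · obtain ⟨h1, h2, h3, h4, h5, h6, h7, h8⟩ := hx
      simp only at h1 h2 h3 h4 h5 h6 h7 h8
      have hmem : ((y, y') : Heis × Heis) ∈ P := by
        refine ⟨lt_of_le_of_lt h1 (by linarith), ?_⟩
        have a1 := dist_le_of_gap_le hM h1 h6 hL h4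
        have a2 := dist_le_of_gap_le hM h2 h7 hL h5
        have a3 := dist_triangle_left y y' x
        have : 0 < M * L := by positivity
        simp only
        linarith
      rw [Set.indicator_of_mem hmem]
      refine (measure_mono ?_).trans (measure_commonStrip_le hs hC hF hM hδ hL hd h1 h2 h8)
      rintro x' ⟨-, -, b3, b4, -, b6, b7, -⟩
      exact ⟨b3, b4, b6, b7⟩
  refine (lintegral_mono h1).trans ?_
  rw [lintegral_indicator_const hPm]
  refine mul_le_mul_right ?_ S
  rw [Measure.prod_apply hPm]
  have h2 : ∀ y : Heis, ν (Prod.mk y ⁻¹' P) ≤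
      (Metric.ball (0 : Heis) (2 * M)).indicator (fun _ => B) y := by
    intro y
    by_cases hy : ‖y‖ < 2 * M
    · rw [Set.indicator_of_mem (by simpa using hy)]
      refine (measure_mono ?_).trans (hF y (11 * M * L) (by positivity))
      rintro y' ⟨-, h⟩
      rw [Metric.mem_ball']
      exact h
    · refine (measure_mono_null (t := ∅) ?_ measure_empty).le.trans zero_le
      rintro y' ⟨h, -⟩
      exact hy h
  refine (lintegral_mono h2).trans ?_
  rw [lintegral_indicator_const measurableSet_ball]
  exact mul_le_mul_right (hF 0 (2 * M) (by positivity)) B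

/-- Fubini on pairs `(θ, y)`: a point at planar distance at least `ρ` from `x` lies in the tubes of
a set of angles of measure at most `4π δ/ρ`. -/
theorem ofReal_le_measure_of_richAngles {ν : Measure Heis} [SFinite ν] {M δ ρ L a h : ℝ}
    (hδ : 0 < δ) (hρ : 0 < ρ) (hh : 0 ≤ h) {x : Heis} {Θ : Set ℝ} (hΘ : MeasurableSet Θ)
    (hsub : Θ ⊆ richAngles ν M δ ρ L a x) (hvol : ENNReal.ofReal h ≤ volume Θ) {Y : Set Heis}
    (hY : ∀ θ ∈ Θ, ∀ y, (θ, y) ∈ tubes M δ ρ L x → y ∈ Y) :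
    ENNReal.ofReal (h * a / (4 * Real.pi * (δ / ρ))) ≤ ν Y := by
  have hb : 0 < 4 * Real.pi * (δ / ρ) := by have := Real.pi_pos; positivity
  have key := mul_le_mul_measure_of_fibres (ν := ν) (measurableSet_tubes M δ ρ L x) hΘ (Y := Y)
    (a := ENNReal.ofReal a) (b := ENNReal.ofReal (4 * Real.pi * (δ / ρ)))
    (fun θ hθ => (hsub hθ).2) hY (fun y => ?_)
  · rw [ENNReal.ofReal_div_of_pos hb, ENNReal.ofReal_mul hh]
    exact ENNReal.div_le_of_le_mul' ((mul_le_mul_left hvol _).trans key)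
  · by_cases hy : ρ ≤ planarDist x y
    · refine (measure_mono ?_).trans (volume_abs_normalGap_lt_le (δ := δ) hρ hy)
      rintro θ ⟨h1, h2⟩
      exact ⟨(hsub h1).1, h2.2.1⟩
    · refine (measure_mono_null (t := ∅) ?_ measure_empty).le.trans zero_le
      rintro θ ⟨-, h2⟩
      exact hy h2.2.2.2.1

/-- The lower bound for the triples: Markov's inequality is applied in `x`, and then in `y` for each
rich `x`. -/
theorem measure_rich_mul_le {ν : Measure Heis} [SFinite ν] {s C M δ ρ L a h : ℝ} (hs : 1 < s)
    (hC : 0 ≤ C)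
    (hF : ∀ x : Heis, ∀ r : ℝ, 0 < r → ν (Metric.ball x r) ≤ ENNReal.ofReal (C * r ^ s))
    (hM : 1 ≤ M) (hδ : 0 < δ) (hL : δ ≤ L) (hρ : 0 < ρ) (hh : 0 < h)
    (hsep : 64 * Real.pi * δ ≤ h * ρ) :
    ENNReal.ofReal (h * a / (4 * Real.pi * (δ / ρ))) *
      (ENNReal.ofReal (h / 2 * a / (4 * Real.pi * (δ / ρ))) *
      ν {x | ‖x‖ ≤ M ∧ ENNReal.ofReal h ≤ volume (richAngles ν M δ ρ L a x)}) ≤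
      ENNReal.ofReal (3 * C * (75 * M ^ 2) ^ s *
          (L * (δ / (h / (8 * Real.pi) * ρ / 2)) ^ (s - 1))) *
        (ENNReal.ofReal (C * (11 * M * L) ^ s) * ENNReal.ofReal (C * (2 * M) ^ s)) := by
  have hpi := Real.pi_pos
  set m := h * a / (4 * Real.pi * (δ / ρ)) with hm
  set m' := h / 2 * a / (4 * Real.pi * (δ / ρ)) with hm'
  -- Chosen so that `4 * π * τ = h / 2`: removing the angles `τ`-close to a given one keeps half of
  -- the measure.
  set τ := h / (8 * Real.pi) with hτ
  have hτ0 : 0 < τ := by positivity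
  set d := τ * ρ / 2 with hd
  have hd0 : 0 < d := by positivity
  have hsep' : 8 * δ ≤ τ * ρ := by
    rw [hτ, div_mul_eq_mul_div, le_div_iff₀ (by positivity)]; linarith
  set W := triples M δ L d with hW
  have hWm : MeasurableSet W := measurableSet_triples M δ L d
  refine le_trans ?_ (measure_triples_le hs hC hF hM hδ hL hd0)
  rw [Measure.prod_apply_symm hWm, ← mul_assoc]
  refine le_trans (mul_le_mul_right (measure_mono ?_) _)
    (mul_meas_ge_le_lintegral (measurable_measure_prodMk_right hWm) _)
  rintro x ⟨hxM, hx⟩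
  set Θ := richAngles ν M δ ρ L a x with hΘ
  have hΘm : MeasurableSet Θ := measurableSet_richAngles ν M δ ρ L a x
  have hWx : MeasurableSet ((fun q : Heis × Heis => (q, x)) ⁻¹' W) := measurable_prodMk_right hWm
  simp only [Set.mem_ofPred_eq]
  rw [Measure.prod_apply hWx, mul_comm]
  have hY : ENNReal.ofReal m ≤ ν {y | ∃ θ ∈ Θ, (θ, y) ∈ tubes M δ ρ L x} :=
    ofReal_le_measure_of_richAngles hδ hρ hh.le hΘm subset_rfl hx
      (fun θ hθ y hy => ⟨θ, hθ, hy⟩)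
  refine le_trans (mul_le_mul_right (hY.trans (measure_mono ?_)) _)
    (mul_meas_ge_le_lintegral (measurable_measure_prodMk_left hWx) _)
  rintro y ⟨θ, hθ, hy⟩
  set Θ' : Set ℝ := Θ ∩ {θ' | τ ≤ |Real.sin (θ' - θ)|} with hΘ'
  have hΘ'm : MeasurableSet Θ' := hΘm.inter
    (isClosed_le (by fun_prop) (by fun_prop)).measurableSet
  have hvol : ENNReal.ofReal (h / 2) ≤ volume Θ' := by
    have h1 : volume Θ ≤ volume Θ' +
        volume {θ' : ℝ | θ' ∈ Set.Ico 0 Real.pi ∧ |Real.sin (θ' - θ)| < τ} := by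
      refine (measure_mono ?_).trans (measure_union_le _ _)
      intro t ht
      rcases le_or_gt τ |Real.sin (t - θ)| with h' | h'
      · exact Or.inl ⟨ht, h'⟩
      · exact Or.inr ⟨ht.1, h'⟩
    have h2 := volume_abs_sin_sub_lt_le (φ := θ) (τ := τ)
      ⟨by linarith [hθ.1.1], hθ.1.2.le⟩
    have e : 4 * Real.pi * τ = h / 2 := by rw [hτ]; field_simp; norm_num
    rw [e] at h2
    have h3 := (hx.trans h1).trans (add_le_add_right h2 _)
    rw [← add_halves h, ENNReal.ofReal_add (by positivity) (by positivity), add_halves h] at h3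
    exact (ENNReal.add_le_add_iff_right ENNReal.ofReal_ne_top).1 h3
  refine ofReal_le_measure_of_richAngles hδ hρ (by positivity) hΘ'm Set.inter_subset_left hvol ?_
  rintro θ' ⟨-, hs'⟩ y' hy'
  obtain ⟨a1, a2, a3, a4, a5⟩ := hy
  obtain ⟨b1, b2, b3, b4, b5⟩ := hy'
  refine ⟨a1, b1, hxM, a5, b5, a3, b3, ?_⟩
  refine separation a4 a2 b2 ?_ hτ0.le hsep'
  rw [← abs_neg, ← Real.sin_neg, neg_sub]
  exact hs'

/-- The constant in `measure_rich_le`. -/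
def richConst (s C M : ℝ) : ℝ :=
  3 * C ^ 3 * (75 * M ^ 2) ^ s * (11 * M) ^ s * (2 * M) ^ s * (16 * Real.pi) ^ (s - 1) *
    (32 * Real.pi ^ 2)

/-- Dividing out the lower bound leaves `ρ` only through `L / ρ`, so all scales with comparable `L`
and `ρ` are equally good. -/
theorem measure_rich_le {ν : Measure Heis} [SFinite ν] {s C M δ ρ L a h : ℝ} (hs : 1 < s)
    (hC : 0 ≤ C)
    (hF : ∀ x : Heis, ∀ r : ℝ, 0 < r → ν (Metric.ball x r) ≤ ENNReal.ofReal (C * r ^ s))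
    (hM : 1 ≤ M) (hδ : 0 < δ) (hL : δ ≤ L) (hρ : 0 < ρ) (hh : 0 < h) (ha : 0 < a)
    (hsep : 64 * Real.pi * δ ≤ h * ρ) :
    ν {x | ‖x‖ ≤ M ∧ ENNReal.ofReal h ≤ volume (richAngles ν M δ ρ L a x)} ≤
      ENNReal.ofReal (richConst s C M * (L / ρ) ^ (s + 1) * (δ / h) ^ (s + 1) / a ^ 2) := by
  have hpi := Real.pi_pos
  have hL0 : 0 < L := hδ.trans_le hL
  have key := measure_rich_mul_le (a := a) hs hC hF hM hδ hL hρ hh hsep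
  have hm : 0 < h * a / (4 * Real.pi * (δ / ρ)) := by positivity
  have hm' : 0 < h / 2 * a / (4 * Real.pi * (δ / ρ)) := by positivity
  rw [← mul_assoc, ← ENNReal.ofReal_mul hm.le, ← ENNReal.ofReal_mul (by positivity),
    ← ENNReal.ofReal_mul (by positivity)] at key
  have h1 := (ENNReal.le_div_iff_mul_le (Or.inl (ENNReal.ofReal_pos.2 (mul_pos hm hm')).ne')
    (Or.inl ENNReal.ofReal_ne_top)).2 ((mul_comm _ _).trans_le key)
  rw [← ENNReal.ofReal_div_of_pos (mul_pos hm hm')] at h1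
  refine h1.trans (ENNReal.ofReal_le_ofReal (le_of_eq ?_))
  have e1 : δ / (h / (8 * Real.pi) * ρ / 2) = 16 * Real.pi * (δ / h) / ρ := by
    field_simp
    norm_num
  have hq : 0 < δ / h := by positivity
  rw [e1, Real.div_rpow (by positivity) hρ.le, Real.mul_rpow (by positivity) hq.le,
    Real.mul_rpow (x := 11 * M) (by positivity) hL0.le,
    Real.div_rpow hL0.le hρ.le,
    show s + 1 = s - 1 + 2 by ring, Real.rpow_add hq, Real.rpow_add hρ,
    show L ^ (s - 1 + 2) = L ^ s * L by
      rw [show s - 1 + 2 = s + 1 by ring, Real.rpow_add_one hL0.ne']]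
  unfold richConst
  have : ρ ^ (s - 1) ≠ 0 := (Real.rpow_pos_of_pos hρ _).ne'
  norm_num
  field_simp
  ring

/-! ### The Frostman constant and pigeonholing over scales -/

theorem IsFrostman.exists_const {ν : Measure Heis} {s : ℝ} (h : IsFrostman ν s) :
    ∃ C : ℝ, 0 ≤ C ∧
      ∀ x : Heis, ∀ r : ℝ, 0 < r → ν (Metric.ball x r) ≤ ENNReal.ofReal (C * r ^ s) := by
  unfold IsFrostman at h
  set T := ⨆ (x : Heis) (r : ℝ) (_ : 0 < r),
    ν (Metric.ball x r) / ENNReal.ofReal (r ^ s) with hT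
  refine ⟨T.toReal, ENNReal.toReal_nonneg, fun x r hr => ?_⟩
  have hrs : 0 < r ^ s := Real.rpow_pos_of_pos hr s
  rw [ENNReal.ofReal_mul ENNReal.toReal_nonneg, ENNReal.ofReal_toReal h.ne]
  rw [← ENNReal.div_le_iff_le_mul (Or.inl (ENNReal.ofReal_pos.2 hrs).ne')
    (Or.inl ENNReal.ofReal_ne_top)]
  exact le_iSup_of_le x (le_iSup_of_le r (le_iSup_of_le hr le_rfl))

theorem continuous_vertProj (θ : ℝ) : Continuous (vertProj θ) := by
  rw [funext (vertProj_eq θ)]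
  refine (PiLp.continuous_toLp 2 _).comp (continuous_pi fun i => ?_)
  fin_cases i
  · show Continuous fun p : Heis => -(p 1 * Real.cos θ - p 0 * Real.sin θ) * Real.sin θ
    fun_prop
  · show Continuous fun p : Heis => (p 1 * Real.cos θ - p 0 * Real.sin θ) * Real.cos θ
    fun_prop
  · show Continuous fun p : Heis => p 2 - (p 0 * Real.cos θ + p 1 * Real.sin θ) *
          (p 1 * Real.cos θ - p 0 * Real.sin θ) / 2
    fun_prop

/-- A rich fibre is rich at one of finitely many scales `ρ 0 < ρ 1 < ⋯ < ρ n`, when the part of it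
at planar distance at most `ρ 0` is negligible. -/
theorem exists_mem_richAngles {ν : Measure Heis} {M δ a : ℝ} {ρ : ℕ → ℝ} {n : ℕ} (hM : 1 ≤ M)
    (hK : ν {y | ¬ ‖y‖ ≤ M} = 0) (ha : 0 < a) (hδ : 0 < δ) (hρ : δ ≤ ρ 0) (hn : 0 < n)
    (hρn : 2 * M ≤ ρ n) {x : Heis} (hx : ‖x‖ ≤ M)
    (hnear : ν (Metric.ball x (6 * M * ρ 0)) ≤ ENNReal.ofReal (a / 4)) {θ : ℝ}
    (hθ : θ ∈ Set.Ico 0 Real.pi)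
    (hrich : ENNReal.ofReal a ≤ (ν.map (vertProj θ)) (Metric.ball (vertProj θ x) δ)) :
    ∃ j < n, θ ∈ richAngles ν M δ (ρ j) (ρ (j + 1)) (a / (2 * n)) x := by
  by_contra! hcon
  rw [Measure.map_apply (continuous_vertProj θ).measurable measurableSet_ball] at hrich
  have hρ0 : 0 < ρ 0 := hδ.trans_le hρ
  have hn' : (0 : ℝ) < n := Nat.cast_pos.2 hn
  have hsub : vertProj θ ⁻¹' Metric.ball (vertProj θ x) δ ⊆
      ({y | ¬ ‖y‖ ≤ M} ∪ Metric.ball x (6 * M * ρ 0)) ∪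
        ⋃ j ∈ Finset.range n, {y | (θ, y) ∈ tubes M δ (ρ j) (ρ (j + 1)) x} := by
    intro y hy
    by_cases hyM : ‖y‖ ≤ M
    swap
    · exact Or.inl (Or.inl hyM)
    have hy' : dist (vertProj θ x) (vertProj θ y) < δ := Metric.mem_ball'.1 hy
    have h1 := abs_normalGap_lt_of_dist_vertProj_lt hy'
    have h2 := abs_gap_le_of_dist_vertProj_lt hM hx hyM hy'
    have hfar : planarDist x y ≤ ρ n := by
      refine ((planarDist_le_dist x y).trans ?_).trans hρn
      rw [dist_eq_norm]
      exact (norm_sub_le _ _).trans (by linarith)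
    classical
    -- The first scale reaching `y` tells which annulus contains it; index `0` means the inner ball.
    have hex : ∃ k, planarDist x y ≤ ρ k := ⟨n, hfar⟩
    have hk := Nat.find_spec hex
    have hkn := Nat.find_min' hex hfar
    rcases hj : Nat.find hex with _ | j
    · rw [hj] at hk
      refine Or.inl (Or.inr ?_)
      rw [Metric.mem_ball']
      refine (dist_le_of_gap_le hM hyM h2 hρ hk).trans_lt ?_
      have : 0 < M * ρ 0 := by positivity
      linarith
    · rw [hj] at hk hkn
      have hlt : ρ j < planarDist x y := not_le.1 (Nat.find_min hex (by omega))
      refine Or.inr ?_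
      simp only [Set.mem_iUnion, Finset.mem_range]
      exact ⟨j, by omega, hyM, h1, h2, hlt.le, hk⟩
  -- Inner ball `a / 4` plus `n` annuli of `a / (2 * n)` each: less than `a` in total.
  have hle : ENNReal.ofReal a ≤ ENNReal.ofReal (3 * a / 4) := by
    refine hrich.trans ((measure_mono hsub).trans ((measure_union_le _ _).trans ?_))
    have h1 : ν ({y | ¬ ‖y‖ ≤ M} ∪ Metric.ball x (6 * M * ρ 0)) ≤ ENNReal.ofReal (a / 4) := by
      refine (measure_union_le _ _).trans ?_
      rw [hK, zero_add]
      exact hnear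
    have h2 : ν (⋃ j ∈ Finset.range n, {y | (θ, y) ∈ tubes M δ (ρ j) (ρ (j + 1)) x}) ≤
        ENNReal.ofReal (a / 2) := by
      refine (measure_biUnion_finset_le _ _).trans ?_
      refine (Finset.sum_le_sum (g := fun _ => ENNReal.ofReal (a / (2 * n)))
        fun j hj => ?_).trans (le_of_eq ?_)
      · by_contra! h
        exact hcon j (Finset.mem_range.1 hj) ⟨hθ, h.le⟩
      · rw [Finset.sum_const, nsmul_eq_mul, Finset.card_range, ← ENNReal.ofReal_natCast,
          ← ENNReal.ofReal_mul hn'.le]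
        congr 1
        field_simp
    refine (add_le_add h1 h2).trans (le_of_eq ?_)
    rw [← ENNReal.ofReal_add (by positivity) (by positivity)]
    congr 1; ring
  rw [ENNReal.ofReal_le_ofReal_iff (by positivity)] at hle
  linarith

theorem exists_le_volume_richAngles {ν : Measure Heis} {M δ a h : ℝ} {ρ : ℕ → ℝ} {n : ℕ}
    (hM : 1 ≤ M) (hK : ν {y | ¬ ‖y‖ ≤ M} = 0) (ha : 0 < a) (hδ : 0 < δ) (hρ : δ ≤ ρ 0)
    (hn : 0 < n) (hρn : 2 * M ≤ ρ n) {x : Heis} (hx : ‖x‖ ≤ M)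
    (hnear : ν (Metric.ball x (6 * M * ρ 0)) ≤ ENNReal.ofReal (a / 4))
    (hrich : ENNReal.ofReal h ≤ volume {θ : ℝ | θ ∈ Set.Ico 0 Real.pi ∧
      ENNReal.ofReal a ≤ (ν.map (vertProj θ)) (Metric.ball (vertProj θ x) δ)}) :
    ∃ j < n, ENNReal.ofReal (h / n) ≤
      volume (richAngles ν M δ (ρ j) (ρ (j + 1)) (a / (2 * n)) x) := by
  by_contra! hcon
  have hn' : (0 : ℝ) < n := Nat.cast_pos.2 hn
  have h1 : ENNReal.ofReal h ≤
      ∑ j ∈ Finset.range n, volume (richAngles ν M δ (ρ j) (ρ (j + 1)) (a / (2 * n)) x) := by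
    refine hrich.trans ((measure_mono ?_).trans (measure_biUnion_finset_le _ _))
    rintro θ ⟨hθ, hr⟩
    obtain ⟨j, hj, hjm⟩ := exists_mem_richAngles hM hK ha hδ hρ hn hρn hx hnear hθ hr
    simp only [Set.mem_iUnion, Finset.mem_range]
    exact ⟨j, hj, hjm⟩
  have h2 := ENNReal.sum_lt_sum_of_nonempty (s := Finset.range n)
    (Finset.nonempty_range_iff.2 hn.ne') (fun j hj => hcon j (Finset.mem_range.1 hj))
  refine (h1.trans_lt h2).ne ?_
  rw [Finset.sum_const, nsmul_eq_mul, Finset.card_range, ← ENNReal.ofReal_natCast,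
    ← ENNReal.ofReal_mul hn'.le]
  congr 1
  field_simp

theorem exists_forall_mul_rpow_le_one (A : ℝ) {p : ℝ} (hp : 0 < p) :
    ∃ δ₀ > (0 : ℝ), ∀ δ : ℝ, 0 < δ → δ < δ₀ → A * δ ^ p ≤ 1 := by
  have hB : 0 < |A| + 1 := by positivity
  refine ⟨((|A| + 1)⁻¹) ^ p⁻¹, by positivity, fun δ h0 h1 => ?_⟩
  have h2 : δ ^ p ≤ (|A| + 1)⁻¹ := by
    have := Real.rpow_le_rpow h0.le h1.le hp.le
    rwa [Real.rpow_inv_rpow (by positivity) hp.ne'] at this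
  have h3 : 0 < δ ^ p := by positivity
  have h4 : (|A| + 1) * δ ^ p ≤ 1 := by
    have := mul_le_mul_of_nonneg_left h2 hB.le
    rwa [mul_inv_cancel₀ hB.ne'] at this
  nlinarith [le_abs_self A]

end Heis

end

/-! ### Choice of exponents and conclusion -/

theorem lemma5p2 (s : ℝ) (hs : 1 < s) (ν : Measure Heis) (hcpt : IsCompact ν.support)
    (hν : Heis.IsFrostman ν s) (κ : ℝ)
    (hκ : max ((s - 1) / 2) (3 * (s - 1) ^ 2 / (4 * s - 3)) < κ) :
    ∃ δ₀ > (0 : ℝ), ∃ η > (0 : ℝ), ∀ δ ∈ Set.Ioo 0 δ₀,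
      ν {x : Heis |
          ENNReal.ofReal (δ ^ η) ≤ μH[1] {θ : ℝ | θ ∈ Set.Ico 0 Real.pi ∧
            ENNReal.ofReal (δ ^ (s - κ)) ≤
              (ν.map (Heis.vertProj θ)) (Metric.ball (Heis.vertProj θ x) δ)}}
        ≤ ENNReal.ofReal (δ ^ η) := by
  have hκ' : (s - 1) / 2 < κ := (le_max_left _ _).trans_lt hκ
  have hκ0 : 0 < κ := by linarith
  obtain ⟨C, hC, hF⟩ := hν.exists_const
  obtain ⟨M, hM, hK⟩ : ∃ M : ℝ, 1 ≤ M ∧ ν {y | ¬ ‖y‖ ≤ M} = 0 := by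
    obtain ⟨M, hM⟩ := hcpt.isBounded.exists_norm_le
    refine ⟨max M 1, le_max_right _ _, measure_mono_null ?_ Measure.measure_compl_support⟩
    intro y hy hy'
    exact hy ((hM y hy').trans (le_max_left _ _))
  have hfin : IsFiniteMeasure ν := by
    refine ⟨?_⟩
    have hsub : (Set.univ : Set Heis) ⊆ {y | ¬ ‖y‖ ≤ M} ∪ Metric.ball 0 (2 * M) := by
      intro y _
      by_cases hy : ‖y‖ ≤ M
      · exact Or.inr (by rw [mem_ball_zero_iff]; linarith)
      · exact Or.inl hy
    refine (measure_mono hsub).trans_lt ((measure_union_le _ _).trans_lt ?_)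
    rw [hK, zero_add]
    exact (hF 0 (2 * M) (by linarith)).trans_lt ENNReal.ofReal_lt_top
  -- The exponent of `δ ^ (s + 1) / (δ ^ (s - κ)) ^ 2`, the gain before losses.
  set β := 2 * κ - (s - 1) with hβ
  have hβ0 : 0 < β := by linarith
  -- The innermost scale is `δ ^ (1 - ε)`; its ball has mass `O(δ ^ (s - κ / 2))`, negligible
  -- against `δ ^ (s - κ)`.
  set ε := κ / (2 * s) with hε
  have hε0 : 0 < ε := by positivity
  have hεs : κ - ε * s = κ / 2 := by rw [hε]; field_simp; norm_num
  -- The first bound gives `64 π δ ≤ h ρ` for small `δ`. The second pays for `s + 1` factors `δ ^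
  -- (-η)` from `L / ρ`, `s + 1` from `h`, and one for the target `δ ^ η`: `2 * s + 3` in all.
  set η := min (ε / 2) (β / (4 * (s + 2))) with hη
  have hη0 : 0 < η := lt_min (by positivity) (by positivity)
  have hηε : 0 < ε - η := by have := min_le_left (ε / 2) (β / (4 * (s + 2))); linarith
  have hηβ : 0 < β - η * (2 * s + 3) := by
    have h1 := min_le_right (ε / 2) (β / (4 * (s + 2)))
    rw [← hη, le_div_iff₀ (by positivity)] at h1
    nlinarith
  -- Then `n * η ≥ 1`, so the last scale is at least `δ ^ (-ε)`, beyond the diameter bound `2 * M`.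
  -- The number of scales is independent of `δ`.
  set n := ⌈1 / η⌉₊ with hn
  have hnη : 1 ≤ n * η := by
    have := Nat.le_ceil (1 / η)
    rwa [div_le_iff₀ hη0] at this
  have hn0 : 0 < n := Nat.ceil_pos.2 (by positivity)
  have hn' : (0 : ℝ) < n := Nat.cast_pos.2 hn0
  set A := n * (Heis.richConst s C M * (n : ℝ) ^ (s + 1) * (2 * n) ^ 2) with hA
  obtain ⟨δ₁, h₁, hδ₁⟩ := Heis.exists_forall_mul_rpow_le_one A hηβ
  obtain ⟨δ₂, h₂, hδ₂⟩ := Heis.exists_forall_mul_rpow_le_one (64 * Real.pi * n) hηε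
  obtain ⟨δ₃, h₃, hδ₃⟩ := Heis.exists_forall_mul_rpow_le_one (4 * C * (6 * M) ^ s)
    (show 0 < κ - ε * s by rw [hεs]; positivity)
  obtain ⟨δ₄, h₄, hδ₄⟩ := Heis.exists_forall_mul_rpow_le_one (2 * M) hε0
  refine ⟨min 1 (min (min δ₁ δ₂) (min δ₃ δ₄)), by positivity, η, hη0, ?_⟩
  rintro δ ⟨hδ, hlt⟩
  simp only [lt_min_iff] at hlt
  obtain ⟨hlt1, ⟨hl1, hl2⟩, hl3, hl4⟩ := hlt
  have e1 := hδ₁ δ hδ hl1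
  have e2 := hδ₂ δ hδ hl2
  have e3 := hδ₃ δ hδ hl3
  have e4 := hδ₄ δ hδ hl4
  set ρ : ℕ → ℝ := fun j => δ ^ (1 - ε - j * η) with hρ
  have hρpos : ∀ j, 0 < ρ j := fun j => Real.rpow_pos_of_pos hδ _
  have hρlow : ∀ j, δ ^ (1 - ε) ≤ ρ j := fun j =>
    Real.rpow_le_rpow_of_exponent_ge hδ hlt1.le (by nlinarith [(Nat.cast_nonneg j : (0 : ℝ) ≤ j)])
  have hδlow : δ ≤ δ ^ (1 - ε) := by
    conv_lhs => rw [← Real.rpow_one δ]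
    exact Real.rpow_le_rpow_of_exponent_ge hδ hlt1.le (by linarith)
  have hratio : ∀ j, ρ (j + 1) / ρ j = δ ^ (-η) := fun j => by
    simp only [hρ]
    rw [← Real.rpow_sub hδ]
    congr 1; push_cast; ring
  have hρn : 2 * M ≤ ρ n := by
    have h5 : δ ^ (-ε) ≤ ρ n :=
      Real.rpow_le_rpow_of_exponent_ge hδ hlt1.le (by linarith)
    refine le_trans ?_ h5
    rw [Real.rpow_neg hδ.le, ← one_div, le_div_iff₀ (by positivity)]
    exact e4
  have ha : 0 < δ ^ (s - κ) := Real.rpow_pos_of_pos hδ _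
  have hnear : ∀ x, ν (Metric.ball x (6 * M * ρ 0)) ≤ ENNReal.ofReal (δ ^ (s - κ) / 4) := by
    intro x
    have hρ0 : ρ 0 = δ ^ (1 - ε) := by simp [hρ]
    refine (hF x _ (mul_pos (by linarith) (hρpos 0))).trans (ENNReal.ofReal_le_ofReal ?_)
    rw [hρ0, Real.mul_rpow (by linarith) (by positivity), ← Real.rpow_mul hδ.le,
      show (1 - ε) * s = (s - κ) + (κ - ε * s) by ring, Real.rpow_add hδ]
    nlinarith
  have hsep : ∀ j, 64 * Real.pi * δ ≤ δ ^ η / n * ρ j := by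
    intro j
    have h6 : δ ^ η / n * δ ^ (1 - ε) ≤ δ ^ η / n * ρ j :=
      mul_le_mul_of_nonneg_left (hρlow j) (by positivity)
    refine le_trans ?_ h6
    rw [div_mul_eq_mul_div, le_div_iff₀ hn']
    have h7 : δ = δ ^ η * δ ^ (1 - ε) * δ ^ (ε - η) := by
      rw [← Real.rpow_add hδ, ← Real.rpow_add hδ]
      conv_lhs => rw [← Real.rpow_one δ]
      congr 1; ring
    have h8 : 0 < δ ^ η * δ ^ (1 - ε) := by positivity
    calc 64 * Real.pi * δ * n
        = δ ^ η * δ ^ (1 - ε) * (64 * Real.pi * n * δ ^ (ε - η)) := by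
          conv_lhs => rw [h7]
          ring
      _ ≤ δ ^ η * δ ^ (1 - ε) := mul_le_of_le_one_right h8.le e2
  set Bad : ℕ → Set Heis := fun j => {x | ‖x‖ ≤ M ∧ ENNReal.ofReal (δ ^ η / n) ≤
    volume (Heis.richAngles ν M δ (ρ j) (ρ (j + 1)) (δ ^ (s - κ) / (2 * n)) x)} with hBad
  set E := Heis.richConst s C M * (δ ^ (-η)) ^ (s + 1) * (δ / (δ ^ η / n)) ^ (s + 1) /
    (δ ^ (s - κ) / (2 * n)) ^ 2 with hE
  have hBadle : ∀ j, ν (Bad j) ≤ ENNReal.ofReal E := by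
    intro j
    have := Heis.measure_rich_le (ν := ν) (M := M) (L := ρ (j + 1)) hs hC hF hM hδ
      (hδlow.trans (hρlow (j + 1))) (hρpos j) (h := δ ^ η / n) (a := δ ^ (s - κ) / (2 * n))
      (by positivity) (by positivity) (hsep j)
    rwa [hratio] at this
  have hEle : n * E ≤ δ ^ η := by
    have h9 : n * E = A * δ ^ (β - η * (2 * s + 3)) * δ ^ η := by
      have q1 : (δ ^ (-η)) ^ (s + 1) = δ ^ (-η * (s + 1)) := (Real.rpow_mul hδ.le _ _).symm
      have q2 : (δ / (δ ^ η / n)) ^ (s + 1) = δ ^ ((1 - η) * (s + 1)) * (n : ℝ) ^ (s + 1) := by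
        rw [Real.rpow_mul hδ.le, Real.rpow_sub hδ, Real.rpow_one,
          ← Real.mul_rpow (by positivity) hn'.le]
        congr 1
        field_simp
      -- The exponent count behind the gain, cleared of denominators.
      have q3 : δ ^ (β - η * (2 * s + 3)) * δ ^ η * (δ ^ (s - κ)) ^ 2 =
          δ ^ (-η * (s + 1)) * δ ^ ((1 - η) * (s + 1)) := by
        rw [← Real.rpow_natCast, ← Real.rpow_mul hδ.le, ← Real.rpow_add hδ, ← Real.rpow_add hδ,
          ← Real.rpow_add hδ]
        congr 1
        rw [hβ]; push_cast; ring
      rw [hE, hA, q1, q2]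
      generalize δ ^ (β - η * (2 * s + 3)) = U at q3 ⊢
      generalize δ ^ (-η * (s + 1)) = X at q3 ⊢
      generalize δ ^ ((1 - η) * (s + 1)) = Y at q3 ⊢
      field_simp
      linear_combination (-(Heis.richConst s C M)) * q3
    rw [h9]
    exact mul_le_of_le_one_left (by positivity) e1
  have hsub : {x : Heis | ENNReal.ofReal (δ ^ η) ≤ μH[1] {θ : ℝ | θ ∈ Set.Ico 0 Real.pi ∧
      ENNReal.ofReal (δ ^ (s - κ)) ≤
        (ν.map (Heis.vertProj θ)) (Metric.ball (Heis.vertProj θ x) δ)}} ⊆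
      {y | ¬ ‖y‖ ≤ M} ∪ ⋃ j ∈ Finset.range n, Bad j := by
    intro x hx
    by_cases hxM : ‖x‖ ≤ M
    swap
    · exact Or.inl hxM
    rw [Set.mem_ofPred_eq, hausdorffMeasure_real] at hx
    obtain ⟨j, hj, hjx⟩ := Heis.exists_le_volume_richAngles hM hK ha hδ
      (hδlow.trans (hρlow 0)) hn0 hρn hxM (hnear x) hx
    refine Or.inr ?_
    simp only [Set.mem_iUnion, Finset.mem_range]
    exact ⟨j, hj, hxM, hjx⟩
  refine (measure_mono hsub).trans ((measure_union_le _ _).trans ?_)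
  rw [hK, zero_add]
  refine (measure_biUnion_finset_le _ _).trans
    ((Finset.sum_le_sum fun j _ => hBadle j).trans ?_)
  rw [Finset.sum_const, nsmul_eq_mul, Finset.card_range, ← ENNReal.ofReal_natCast,
    ← ENNReal.ofReal_mul hn'.le]
  exact ENNReal.ofReal_le_ofReal hEle
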